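/- Let $q$ be a prime power and write $\theta_{m,s}=s^m+s^{m-1}+\dots+s+1$. For $1\le r\le k\le N$, let $\mathcal C_q(N,k,r)$ denote the minimum number of elements of a $q$-covering design $\mathbb C_q(N,k,r)$, i.e. of a collection of $(k-1)$-dimensional projective subspaces of $\mathrm{PG}(N-1,q)$ such that every $(r-1)$-dimensional projective subspace of $\mathrm{PG}(N-1,q)$ is contained in at least one member of the collection. If $n\ge 3$, then $$\left\lceil \frac{\theta_{n-1,q^2}\,\theta_{2n-2,q}}{q^2+q+1}\right\rceil \;\le\; \mathcal C_q(2n,3,2)\;\le\; q^{2n-2}\,\theta_{n-2,q^2}+q^{2n-3}-1+\sum_{i=2}^{n-1}\left(\theta_{4i-5,q}-\theta_{2i-4,q}+q^{2i-2}\right).$$ -/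

import Mathlib

/-- `theta m q = q ^ m + ⋯ + q + 1`, the number of points of the `m`-dimensional projective space
over the field with `q` elements. -/
def theta (m q : ℕ) : ℕ := ∑ i ∈ Finset.range (m + 1), q ^ i

/-- A `q`-covering design with parameters `(n, k, r)`, where `K` is the field with `q` elements:
a collection `X` of `(k - 1)`-spaces of `PG(n - 1, q)`, that is of `k`-dimensional vector subspaces
of `K ^ n`, such that every `(r - 1)`-space of `PG(n - 1, q)` is contained in at least one element
of `X`. -/
structure IsCoveringDesign {K : Type*} [Field K] (n k r : ℕ)
    (X : Finset (Submodule K (Fin n → K))) : Prop where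
  finrank_eq : ∀ U ∈ X, Module.finrank K U = k
  covers : ∀ W : Submodule K (Fin n → K), Module.finrank K W = r → ∃ U ∈ X, W ≤ U

/-- The covering number `C_q(n, k, r)`, where `K` is the field with `q` elements: the minimum number
of elements of a `q`-covering design with parameters `(n, k, r)`. -/
noncomputable def coveringNumber (K : Type*) [Field K] (n k r : ℕ) : ℕ :=
  sInf {m : ℕ | ∃ X : Finset (Submodule K (Fin n → K)), IsCoveringDesign n k r X ∧ X.card = m}

/-- For `r ≤ k ≤ n` the infimum that defines the covering number is attained. -/
theorem exists_isCoveringDesign_card_eq (K : Type*) [Field K] [Finite K] {n k r : ℕ}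
    (hrk : r ≤ k) (hkn : k ≤ n) :
    ∃ X : Finset (Submodule K (Fin n → K)),
      IsCoveringDesign n k r X ∧ X.card = coveringNumber K n k r := by
  classical
  have : Finite (Submodule K (Fin n → K)) := Finite.of_injective _ SetLike.coe_injective
  have hfin := Set.toFinite {U : Submodule K (Fin n → K) | Module.finrank K U = k}
  have ext : ∀ d : ℕ, ∀ W : Submodule K (Fin n → K), Module.finrank K W + d ≤ n →
      ∃ U, W ≤ U ∧ Module.finrank K U = Module.finrank K W + d := by
    intro d
    induction d with
    | zero => exact fun W _ => ⟨W, le_rfl, rfl⟩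
    | succ d ih =>
      intro W hW
      obtain ⟨U, hWU, hU⟩ := ih W (by omega)
      have hne : U ≠ ⊤ := by
        rintro rfl
        rw [finrank_top, Module.finrank_fin_fun] at hU
        omega
      obtain ⟨v, -, hv⟩ := SetLike.exists_of_lt (lt_top_iff_ne_top.2 hne)
      refine ⟨U ⊔ Submodule.span K {v}, hWU.trans le_sup_left, ?_⟩
      have h0 : v ≠ 0 := fun h => hv (h ▸ U.zero_mem)
      have hd : U ⊓ Submodule.span K {v} = ⊥ :=
        ((Submodule.disjoint_span_singleton' h0).2 hv).eq_bot
      have := Submodule.finrank_sup_add_finrank_inf_eq U (Submodule.span K {v})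
      rw [hd, finrank_bot, finrank_span_singleton h0] at this
      omega
  refine Nat.sInf_mem (s := {m : ℕ | ∃ X : Finset (Submodule K (Fin n → K)),
    IsCoveringDesign n k r X ∧ X.card = m}) ⟨_, hfin.toFinset, ⟨?_, ?_⟩, rfl⟩
  · intro U hU
    simpa using hU
  · intro W hW
    obtain ⟨U, hWU, hU⟩ := ext (k - r) W (by omega)
    exact ⟨U, by simp [hU, hW, hrk], hWU⟩

/-! Lower bound: every ordered pair of independent vectors lies in a member of the design, and each
member contains (q³-1)(q³-q) such pairs. Upper bound: split the space as A × F with F = GF(q^m), dim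
A = 3, and let σ generate Gal(F/K). A line disjoint from 0 × F lies in a plane {(u, au + bσu)},
because two independent values determine a and b (`exists_interpolation`); there are q^(2m) such
planes. A line meeting 0 × F in a point lies over a point p of PG(A) and is covered by affine planes
over p, built from the cosets of lines that cover PG(F). For one point p₀ these are replaced by a
smaller design on Kp₀ ⊕ F, which also covers the lines inside 0 × F. This is the recursion
`LineCoverable.step`. The recursion starts in PG(5,q) (`lineCoverable_six`), with A = F = GF(q³).
The q³ maps with a = -σb form an alternating family f. Trading their graphs for (q²+q+1)q other
planes makes one affine plane over each of the q²+q+1 points redundant: a net gain of 1. -/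

open Module
open scoped LinearAlgebra.Projectivization

/-- Every line of `PG(V)` lies in one of at most `N` subspaces of vector dimension at most `3`. -/
def LineCoverable (K V : Type*) [Field K] [AddCommGroup V] [Module K V] (N : ℕ) : Prop :=
  ∃ X : Finset (Submodule K V), X.card ≤ N ∧ (∀ U ∈ X, finrank K U ≤ 3) ∧
    ∀ W : Submodule K V, finrank K W = 2 → ∃ U ∈ X, W ≤ U

/-! ### Line covers and the double count -/

section General

variable {K V V' : Type*} [Field K] [AddCommGroup V] [Module K V] [AddCommGroup V'] [Module K V']

theorem LineCoverable.of_linearEquiv {N : ℕ} (h : LineCoverable K V N) (e : V ≃ₗ[K] V') :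
    LineCoverable K V' N := by
  classical
  obtain ⟨X, hX, h3, hc⟩ := h
  refine ⟨X.image (Submodule.map (e : V →ₗ[K] V')), Finset.card_image_le.trans hX, ?_, ?_⟩
  · intro U hU
    obtain ⟨U', hU', rfl⟩ := Finset.mem_image.1 hU
    exact (LinearEquiv.finrank_map_eq e U').trans_le (h3 U' hU')
  · intro W hW
    obtain ⟨U, hU, hWU⟩ := hc (W.map (e.symm : V' →ₗ[K] V))
      ((LinearEquiv.finrank_map_eq e.symm W).trans hW)
    refine ⟨_, Finset.mem_image_of_mem _ hU, fun w hw => ⟨e.symm w, hWU ⟨w, hw, rfl⟩, ?_⟩⟩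
    simp

theorem exists_le_finrank_eq [FiniteDimensional K V] (U : Submodule K V) {d : ℕ}
    (hU : finrank K U ≤ d) (hd : d ≤ finrank K V) :
    ∃ U' : Submodule K V, U ≤ U' ∧ finrank K U' = d := by
  induction d, hU using Nat.le_induction with
  | base => exact ⟨U, le_rfl, rfl⟩
  | succ d hUd ih =>
    obtain ⟨U', hUU', hU'⟩ := ih (by omega)
    have hne : U' ≠ ⊤ := by
      rintro rfl
      rw [finrank_top] at hU'
      omega
    obtain ⟨v, -, hv⟩ := SetLike.exists_of_lt (lt_top_iff_ne_top.2 hne)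
    refine ⟨U' ⊔ Submodule.span K {v}, hUU'.trans le_sup_left, ?_⟩
    have h0 : v ≠ 0 := fun h => hv (h ▸ U'.zero_mem)
    have hdis : U' ⊓ Submodule.span K {v} = ⊥ :=
      ((Submodule.disjoint_span_singleton' h0).2 hv).eq_bot
    have := Submodule.finrank_sup_add_finrank_inf_eq U' (Submodule.span K {v})
    rw [hdis, finrank_bot, finrank_span_singleton h0] at this
    omega

/-- Small subspaces are enlarged to dimension 3 and coincidences only lower the count, so the
inequalities in `LineCoverable` lose nothing. -/
theorem LineCoverable.coveringNumber_le {n N : ℕ} (hn : 3 ≤ n)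
    (h : LineCoverable K (Fin n → K) N) : coveringNumber K n 3 2 ≤ N := by
  classical
  obtain ⟨X, hX, h3, hc⟩ := h
  choose! f hf hf3 using fun (U : Submodule K (Fin n → K)) (hU : U ∈ X) =>
    exists_le_finrank_eq U (h3 U hU) (by simpa using hn)
  have hdes : IsCoveringDesign n 3 2 (X.image f) := by
    refine ⟨fun U hU => ?_, fun W hW => ?_⟩
    · obtain ⟨U', hU', rfl⟩ := Finset.mem_image.1 hU
      exact hf3 U' hU'
    · obtain ⟨U, hU, hWU⟩ := hc W hW
      exact ⟨f U, Finset.mem_image_of_mem f hU, hWU.trans (hf U hU)⟩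
  have hle : coveringNumber K n 3 2 ≤ (X.image f).card := Nat.sInf_le ⟨_, hdes, rfl⟩
  exact hle.trans (Finset.card_image_le.trans hX)

/-- Counting ordered pairs of independent vectors gives a lower bound for covering designs. -/
theorem IsCoveringDesign.mul_le_card_mul [Finite K] {n : ℕ} (hn : 2 ≤ n)
    {X : Finset (Submodule K (Fin n → K))} (hX : IsCoveringDesign n 3 2 X) :
    (Nat.card K ^ n - 1) * (Nat.card K ^ n - Nat.card K) ≤
      X.card * ((Nat.card K ^ 3 - 1) * (Nat.card K ^ 3 - Nat.card K)) := by
  have := Fintype.ofFinite K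
  have h1 := card_linearIndependent (K := K) (V := Fin n → K) (k := 2) (by simpa using hn)
  have h2 : ∀ U ∈ X, Nat.card {s : Fin 2 → U // LinearIndependent K s} =
      (Nat.card K ^ 3 - 1) * (Nat.card K ^ 3 - Nat.card K) := by
    intro U hU
    rw [card_linearIndependent (by rw [hX.finrank_eq U hU]; norm_num), hX.finrank_eq U hU]
    simp [Fin.prod_univ_two]
  have h3 : ∀ s : {s : Fin 2 → (Fin n → K) // LinearIndependent K s},
      ∃ U : X, ∀ i, s.1 i ∈ U.1 := by
    intro s
    obtain ⟨U, hU, hle⟩ := hX.covers (Submodule.span K (Set.range s.1))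
      (by rw [finrank_span_eq_card s.2]; simp)
    exact ⟨⟨U, hU⟩, fun i => hle (Submodule.subset_span ⟨i, rfl⟩)⟩
  choose f hf using h3
  -- A pair is sent to itself inside a chosen member containing its span; forgetting the member
  -- recovers the pair, so `g` is injective.
  let g : {s : Fin 2 → (Fin n → K) // LinearIndependent K s} →
      Σ U : X, {s : Fin 2 → U.1 // LinearIndependent K s} := fun s =>
    ⟨f s, fun i => ⟨s.1 i, hf s i⟩, LinearIndependent.of_comp (f s).1.subtype s.2⟩
  have hg : Function.Injective g := by
    have key : ∀ s, (fun i => (((g s).2.1 i : (g s).1.1) : Fin n → K)) = s.1 := fun s => rfl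
    intro s t hst
    apply Subtype.ext
    rw [← key s, ← key t, hst]
  have h4 := Nat.card_le_card_of_injective g hg
  rw [h1, Nat.card_sigma] at h4
  rw [Finset.sum_congr rfl (fun U _ => h2 U.1 U.2)] at h4
  simpa [Fin.prod_univ_two] using h4

end General

/-! ### Geometric sums and the lower bound -/

theorem theta_succ (m q : ℕ) : theta (m + 1) q = theta m q + q ^ (m + 1) :=
  Finset.sum_range_succ _ _

theorem theta_mul_sub_one (m q : ℕ) : (theta m q : ℚ) * ((q : ℚ) - 1) = (q : ℚ) ^ (m + 1) - 1 := by
  rw [theta]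
  push_cast
  exact geom_sum_mul _ _

theorem ceil_le_coveringNumber {K : Type*} [Field K] [Finite K] (q : ℕ) (hq : Nat.card K = q)
    (n : ℕ) (hn : 2 ≤ n) :
    ⌈((theta (n - 1) (q ^ 2) : ℚ) * (theta (2 * n - 2) q : ℚ)) / ((q : ℚ) ^ 2 + (q : ℚ) + 1)⌉
        ≤ (coveringNumber K (2 * n) 3 2 : ℤ) := by
  obtain ⟨X, hX, hcard⟩ := exists_isCoveringDesign_card_eq K (n := 2 * n) (k := 3) (r := 2)
    (by norm_num) (by omega)
  have h := hX.mul_le_card_mul (by omega)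
  rw [hcard, hq] at h
  have hq1 : 1 < q := hq ▸ Finite.one_lt_card
  have hq1' : (1 : ℚ) < q := by exact_mod_cast hq1
  obtain ⟨k, rfl⟩ : ∃ k, n = k + 1 := ⟨n - 1, by omega⟩
  have e1 := theta_mul_sub_one k (q ^ 2)
  have e2 := theta_mul_sub_one (2 * k) q
  rw [Int.ceil_le, div_le_iff₀ (by positivity)]
  have p1 : 1 ≤ q ^ (2 * (k + 1)) := Nat.one_le_pow _ _ (by omega)
  have p2 : q ≤ q ^ (2 * (k + 1)) := Nat.le_self_pow (by omega) _
  have p3 : 1 ≤ q ^ 3 := Nat.one_le_pow _ _ (by omega)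
  have p4 : q ≤ q ^ 3 := Nat.le_self_pow (by omega) _
  have h' : ((q : ℚ) ^ (2 * (k + 1)) - 1) * ((q : ℚ) ^ (2 * (k + 1)) - q) ≤
      coveringNumber K (2 * (k + 1)) 3 2 * (((q : ℚ) ^ 3 - 1) * ((q : ℚ) ^ 3 - q)) := by
    have := (Nat.cast_le (α := ℚ)).2 h
    push_cast [Nat.cast_sub p1, Nat.cast_sub p2, Nat.cast_sub p3, Nat.cast_sub p4] at this
    exact this
  simp only [Nat.add_sub_cancel, show 2 * (k + 1) - 2 = 2 * k by omega]
  push_cast at e1 ⊢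
  set a : ℚ := (theta k (q ^ 2) : ℚ)
  set b : ℚ := (theta (2 * k) q : ℚ)
  set c : ℚ := (coveringNumber K (2 * (k + 1)) 3 2 : ℚ)
  rw [← pow_mul] at e1
  have e3 : (q : ℚ) ^ (2 * (k + 1)) - q = q * (b * (q - 1)) := by rw [e2]; ring
  rw [e3, ← e1] at h'
  -- This is the factor common to both sides: (q³-1)(q³-q) = (q²+q+1)(q²-1)q(q-1).
  have hpos : (0 : ℚ) < ((q : ℚ) ^ 2 - 1) * (q * (q - 1)) := by
    apply mul_pos <;> nlinarith
  refine le_of_mul_le_mul_right ?_ hpos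
  calc a * b * (((q : ℚ) ^ 2 - 1) * (q * (q - 1)))
      = a * ((q : ℚ) ^ 2 - 1) * (q * (b * (q - 1))) := by ring
    _ ≤ _ := h'
    _ = _ := by ring

/-! ### Lines of a product and affine planes -/

section Product

variable {K A S : Type*} [Field K] [AddCommGroup A] [Module K A] [AddCommGroup S] [Module K S]

/-- A line of `PG(A × S)` is disjoint from, meets in a point, or lies in the subspace `0 × S`. -/
theorem finrank_two_cases (W : Submodule K (A × S)) (hW : finrank K W = 2) :
    (∃ (u v : A) (s t : S), LinearIndependent K ![u, v] ∧
      W = Submodule.span K {(u, s), (v, t)}) ∨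
    (∃ (p : ℙ K A) (y z : S), z ≠ 0 ∧ W = Submodule.span K {(p.rep, y), (0, z)}) ∨
    ∃ L : Submodule K S, finrank K L = 2 ∧ W = L.map (LinearMap.inr K A S) := by
  have hlin : ∀ (x : A) (y z : S), x ≠ 0 → z ≠ 0 → W = Submodule.span K {(x, y), (0, z)} →
      ∃ (p : ℙ K A) (y z : S), z ≠ 0 ∧ W = Submodule.span K {(p.rep, y), (0, z)} := by
    intro x y z hx hz h
    obtain ⟨a, ha⟩ := Projectivization.exists_smul_eq_mk_rep K x hx
    refine ⟨Projectivization.mk K x hx, a • y, z, hz, ?_⟩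
    rw [← ha, h, ← Prod.smul_mk, Submodule.span_insert, Submodule.span_insert,
      show (a • (x, y) : A × S) = (a : K) • (x, y) from rfl,
      Submodule.span_singleton_smul_eq a.isUnit]
  have hfin : FiniteDimensional K W := FiniteDimensional.of_finrank_pos (by omega)
  let b := finBasisOfFinrankEq K W hW
  obtain ⟨⟨⟨u, s⟩, hw₁⟩, hb₁⟩ : ∃ w, b 0 = w := ⟨_, rfl⟩
  obtain ⟨⟨⟨v, t⟩, hw₂⟩, hb₂⟩ : ∃ w, b 1 = w := ⟨_, rfl⟩
  have hli : LinearIndependent K ![((u, s) : A × S), (v, t)] := by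
    have := b.linearIndependent.map' W.subtype (Submodule.ker_subtype W)
    have e : W.subtype ∘ b = ![((u, s) : A × S), (v, t)] := by
      funext i
      fin_cases i <;> simp [hb₁, hb₂]
    rwa [e] at this
  have hsp : W = Submodule.span K {(u, s), (v, t)} := by
    have h1 := congrArg (Submodule.map W.subtype) b.span_eq
    rw [Submodule.map_span, Submodule.map_top, Submodule.range_subtype, ← Set.range_comp] at h1
    rw [← h1]
    congr 1
    ext w
    simp [Fin.exists_fin_two, hb₁, hb₂, eq_comm]
  rw [LinearIndependent.pair_iff] at hli
  -- The three cases are the rank 0, 1 or 2 of the projections u, v to A.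
  by_cases hv : v = 0
  · subst hv
    by_cases hu : u = 0
    · subst hu
      refine Or.inr (Or.inr ⟨W.comap (LinearMap.inr K A S), ?_, ?_⟩)
      all_goals
        have hmap : (W.comap (LinearMap.inr K A S)).map (LinearMap.inr K A S) = W := by
          rw [Submodule.map_comap_eq, inf_eq_right, hsp, Submodule.span_le]
          rintro w (rfl | rfl) <;> simp
      · rw [← hW]
        conv_rhs => rw [← hmap]
        exact (LinearEquiv.finrank_eq (Submodule.equivMapOfInjective _ LinearMap.inr_injective _))
      · exact hmap.symm
    · refine Or.inr (Or.inl (hlin u s t hu ?_ hsp))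
      rintro rfl
      simpa using hli 0 1 (by simp)
  · by_cases huv : ∃ k : K, k • v = u
    · obtain ⟨k, rfl⟩ := huv
      refine Or.inr (Or.inl (hlin v t (s - k • t) hv ?_ ?_))
      · intro h
        have := hli 1 (-k) (by
          ext
          · simp
          · simp [← sub_eq_add_neg, h])
        simpa using this.1
      · rw [hsp]
        have e : ((k • v, s) : A × S) = k • (v, t) + (0, s - k • t) := by ext <;> simp
        apply le_antisymm
        · rw [Submodule.span_le]
          have h1 : ((v, t) : A × S) ∈ Submodule.span K {(v, t), ((0 : A), s - k • t)} :=
            Submodule.subset_span (by simp)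
          rintro w (rfl | rfl)
          · rw [e]
            exact add_mem (Submodule.smul_mem _ _ h1) (Submodule.subset_span (by simp))
          · exact h1
        · rw [Submodule.span_le]
          rintro w (rfl | rfl)
          · exact Submodule.subset_span (by simp)
          · have e' : ((0, s - k • t) : A × S) = (k • v, s) - k • (v, t) := by ext <;> simp
            rw [e']
            exact sub_mem (Submodule.subset_span (by simp))
              (Submodule.smul_mem _ _ (Submodule.subset_span (by simp)))
    · refine Or.inl ⟨u, v, s, t, ?_, hsp⟩
      rw [LinearIndependent.pair_symm_iff, LinearIndependent.pair_iff' hv]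
      exact fun a ha => huv ⟨a, ha⟩

/-- The affine plane with direction `L` through `(x, c)`, as a projective plane. -/
def affinePlane (x : A) (D : Submodule K S × S) : Submodule K (A × S) :=
  Submodule.span K {(x, D.2)} ⊔ D.1.map (LinearMap.inr K A S)

theorem finrank_affinePlane_le [FiniteDimensional K A] [FiniteDimensional K S] (x : A)
    (D : Submodule K S × S) (hD : finrank K D.1 = 2) : finrank K (affinePlane x D) ≤ 3 := by
  have h1 := Submodule.finrank_add_le_finrank_add_finrank (Submodule.span K {(x, D.2)})
    (D.1.map (LinearMap.inr K A S))
  have h2 := finrank_span_le_card (R := K) ({(x, D.2)} : Set (A × S))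
  have h3 := Submodule.finrank_map_le (LinearMap.inr K A S) D.1
  simp only [Set.toFinset_singleton, Finset.card_singleton] at h2
  rw [affinePlane]
  omega

theorem inr_mem_affinePlane (x : A) (D : Submodule K S × S) {z : S} (hz : z ∈ D.1) :
    ((0, z) : A × S) ∈ affinePlane x D :=
  Submodule.mem_sup_right ⟨z, hz, rfl⟩

theorem mem_affinePlane (x : A) (D : Submodule K S × S) {y : S} (hy : y - D.2 ∈ D.1) :
    (x, y) ∈ affinePlane x D := by
  have e : (x, y) = (x, D.2) + (0, y - D.2) := by ext <;> simp
  rw [e]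
  exact add_mem (Submodule.mem_sup_left (Submodule.mem_span_singleton_self _))
    (inr_mem_affinePlane x D hy)

theorem span_le_affinePlane (x : A) (D : Submodule K S × S) {y z : S} (hy : y - D.2 ∈ D.1)
    (hz : z ∈ D.1) : Submodule.span K {(x, y), (0, z)} ≤ affinePlane x D := by
  rw [Submodule.span_le]
  rintro w (rfl | rfl)
  exacts [mem_affinePlane x D hy, inr_mem_affinePlane x D hz]

end Product

/-! ### Cosets, pencils and point covers -/

section Covers

variable {K S : Type*} [Field K] [AddCommGroup S] [Module K S]

/-- Every point of `PG(S)` lies on one of at most `N` lines. -/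
def PointCoverable (K S : Type*) [Field K] [AddCommGroup S] [Module K S] (N : ℕ) : Prop :=
  ∃ X : Finset (Submodule K S), X.card ≤ N ∧ (∀ L ∈ X, finrank K L = 2) ∧
    ∀ z : S, z ≠ 0 → ∃ L ∈ X, z ∈ L

theorem natCard_quotient [Finite K] [FiniteDimensional K S] (L : Submodule K S) :
    Nat.card (S ⧸ L) = Nat.card K ^ (finrank K S - finrank K L) := by
  rw [Module.natCard_eq_pow_finrank (K := K), Submodule.finrank_quotient]

/-- Representatives of the cosets of all lines in a family. -/
theorem exists_coset_family [Finite K] [FiniteDimensional K S] (X : Finset (Submodule K S))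
    (hX : ∀ L ∈ X, finrank K L = 2) :
    ∃ D : Finset (Submodule K S × S), D.card ≤ X.card * Nat.card K ^ (finrank K S - 2) ∧
      (∀ d ∈ D, d.1 ∈ X) ∧ (∀ L ∈ X, ∀ y : S, ∃ d ∈ D, d.1 = L ∧ y - d.2 ∈ L) ∧
      ∀ L ∈ X, ∃ d ∈ D, d.1 = L ∧ d.2 ∈ L := by
  classical
  have : Finite S := Module.finite_of_finite K
  have hfin : ∀ L : Submodule K S, Finite (S ⧸ L) := fun L => Module.finite_of_finite K
  have : ∀ L : Submodule K S, Fintype (S ⧸ L) := fun L => Fintype.ofFinite _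
  refine ⟨X.biUnion fun L => (Finset.univ : Finset (S ⧸ L)).image fun c => (L, c.out), ?_, ?_, ?_, ?_⟩
  · refine Finset.card_biUnion_le_card_mul _ _ _ fun L hL => Finset.card_image_le.trans ?_
    rw [Finset.card_univ, Fintype.card_eq_nat_card, natCard_quotient, hX L hL]
  · intro d hd
    simp only [Finset.mem_biUnion, Finset.mem_image] at hd
    obtain ⟨L, hL, c, -, rfl⟩ := hd
    exact hL
  · intro L hL y
    refine ⟨(L, (Submodule.Quotient.mk (p := L) y).out), ?_, rfl, ?_⟩
    · simp only [Finset.mem_biUnion, Finset.mem_image]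
      exact ⟨L, hL, _, Finset.mem_univ _, rfl⟩
    · rw [← Submodule.Quotient.eq]
      exact (Quotient.out_eq _).symm
  -- The zero coset is singled out because `lineCoverable_six` discards it.
  · intro L hL
    refine ⟨(L, (0 : S ⧸ L).out), ?_, rfl, ?_⟩
    · simp only [Finset.mem_biUnion, Finset.mem_image]
      exact ⟨L, hL, _, Finset.mem_univ _, rfl⟩
    · rw [← Submodule.Quotient.mk_eq_zero]
      exact Quotient.out_eq _

/-- The pencil of lines through a point of a given line of a projective plane. -/
theorem exists_pencil [Finite K] (hS : finrank K S = 3) (L : Submodule K S)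
    (hL : finrank K L = 2) :
    ∃ X : Finset (Submodule K S), X.card ≤ Nat.card K + 1 ∧ L ∈ X ∧ (∀ M ∈ X, finrank K M = 2) ∧
      ∀ z : S, ∃ M ∈ X, z ∈ M := by
  classical
  have := Fintype.ofFinite K
  have hfd : FiniteDimensional K S := FiniteDimensional.of_finrank_pos (by omega)
  have hLt : L < ⊤ := lt_top_iff_ne_top.2 (by rintro rfl; rw [finrank_top] at hL; omega)
  obtain ⟨r, -, hr⟩ := SetLike.exists_of_lt hLt
  let b := finBasisOfFinrankEq K L hL
  obtain ⟨s, hs⟩ : ∃ s : S, (b 0 : S) = s := ⟨_, rfl⟩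
  obtain ⟨t, ht⟩ : ∃ t : S, (b 1 : S) = t := ⟨_, rfl⟩
  have hLs : ∀ z ∈ L, ∃ α β : K, z = α • s + β • t := by
    intro z hz
    refine ⟨b.repr ⟨z, hz⟩ 0, b.repr ⟨z, hz⟩ 1, ?_⟩
    have h := b.sum_repr ⟨z, hz⟩
    rw [Fin.sum_univ_two] at h
    rw [← hs, ← ht]
    exact (congrArg Subtype.val h).symm
  have hs0 : s ≠ 0 := fun h => b.ne_zero 0 (Subtype.ext (hs.trans h))
  have hsL : s ∈ L := hs ▸ (b 0).2
  have htL : t ∈ L := ht ▸ (b 1).2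
  have htop : L ⊔ Submodule.span K {r} = ⊤ := by
    have h0 : r ≠ 0 := fun h => hr (h ▸ L.zero_mem)
    have hdis : L ⊓ Submodule.span K {r} = ⊥ :=
      ((Submodule.disjoint_span_singleton' h0).2 hr).eq_bot
    have := Submodule.finrank_sup_add_finrank_inf_eq L (Submodule.span K {r})
    rw [hdis, finrank_bot, finrank_span_singleton h0] at this
    exact Submodule.eq_top_of_finrank_eq (by omega)
  -- The lines through s other than L join s to the points r + kt.
  refine ⟨insert L (Finset.univ.image fun k : K => Submodule.span K (Set.range ![s, r + k • t])),
    ?_, Finset.mem_insert_self _ _, ?_, ?_⟩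
  · refine (Finset.card_insert_le _ _).trans (Nat.add_le_add_right ?_ 1)
    exact Finset.card_image_le.trans (by rw [Finset.card_univ, Fintype.card_eq_nat_card])
  · intro M hM
    rcases Finset.mem_insert.1 hM with rfl | hM
    · exact hL
    · obtain ⟨k, -, rfl⟩ := Finset.mem_image.1 hM
      rw [finrank_span_eq_card, Fintype.card_fin]
      rw [LinearIndependent.pair_iff' hs0]
      intro a ha
      apply hr
      rw [← sub_eq_iff_eq_add] at ha
      rw [← ha]
      exact sub_mem (L.smul_mem _ hsL) (L.smul_mem _ htL)
  · intro z
    have hz : z ∈ L ⊔ Submodule.span K {r} := htop ▸ Submodule.mem_top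
    obtain ⟨y, hy, w, hw, rfl⟩ := Submodule.mem_sup.1 hz
    obtain ⟨γ, rfl⟩ := Submodule.mem_span_singleton.1 hw
    by_cases hγ : γ = 0
    · exact ⟨L, Finset.mem_insert_self _ _, by simpa [hγ] using hy⟩
    · obtain ⟨α, β, rfl⟩ := hLs y hy
      refine ⟨_, Finset.mem_insert_of_mem (Finset.mem_image_of_mem _
        (Finset.mem_univ (γ⁻¹ * β))), ?_⟩
      have e : α • s + β • t + γ • r = α • s + γ • (r + (γ⁻¹ * β) • t) := by
        rw [smul_add, smul_smul, mul_inv_cancel_left₀ hγ]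
        abel
      rw [e]
      exact add_mem (Submodule.smul_mem _ _ (Submodule.subset_span ⟨0, rfl⟩))
        (Submodule.smul_mem _ _ (Submodule.subset_span ⟨1, rfl⟩))

theorem PointCoverable.of_linearEquiv {S' : Type*} [AddCommGroup S'] [Module K S'] {N : ℕ}
    (h : PointCoverable K S N) (e : S ≃ₗ[K] S') : PointCoverable K S' N := by
  classical
  obtain ⟨X, hX, h2, hc⟩ := h
  refine ⟨X.image (Submodule.map (e : S →ₗ[K] S')), Finset.card_image_le.trans hX, ?_, ?_⟩
  · intro U hU
    obtain ⟨U', hU', rfl⟩ := Finset.mem_image.1 hU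
    exact (LinearEquiv.finrank_map_eq e U').trans (h2 U' hU')
  · intro z hz
    obtain ⟨U, hU, hzU⟩ := hc (e.symm z) (by simpa using hz)
    exact ⟨_, Finset.mem_image_of_mem _ hU, e.symm z, hzU, by simp⟩

end Covers

/-! ### Cyclic extensions of finite fields -/

section Fields

/-- A finite field has cyclic extensions of every degree. -/
theorem exists_cyclic_extension (K : Type*) [Field K] [Finite K] (m : ℕ) (hm : m ≠ 0) :
    ∃ (F : Type) (_ : Field F) (_ : Algebra K F) (_ : Finite F) (_ : IsGalois K F)
      (σ : F ≃ₐ[K] F), finrank K F = m ∧ (∀ x, σ x = x → ∃ k, algebraMap K F k = x) ∧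
      ∀ x, σ^[m] x = x := by
  obtain ⟨p, hp⟩ := CharP.exists K
  have : Fact p.Prime := ⟨(CharP.char_is_prime_or_zero K p).resolve_right
    (CharP.char_ne_zero_of_finite K p)⟩
  have : NeZero m := ⟨hm⟩
  refine ⟨FiniteField.Extension K p m, inferInstance, inferInstance, inferInstance, inferInstance,
    FiniteField.Extension.frob K p m, FiniteField.finrank_extension K p m, ?_, ?_⟩
  -- Powers of the Frobenius exhaust the Galois group, so its fixed points lie in K.
  · intro x hx
    have : x ∈ (⊥ : IntermediateField K (FiniteField.Extension K p m)) := by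
      rw [IsGalois.mem_bot_iff_fixed]
      intro g
      obtain ⟨i, -, rfl⟩ := FiniteField.Extension.exists_frob_pow_eq K p m g
      rw [AlgEquiv.coe_pow]
      exact Function.iterate_fixed hx i
    exact IntermediateField.mem_bot.1 this
  · intro x
    have := Fintype.ofFinite (FiniteField.Extension K p m)
    rw [← AlgEquiv.coe_pow, FiniteField.Extension.frob_iterate_apply, ← FiniteField.natCard_extension K p m,
      ← Fintype.card_eq_nat_card, FiniteField.pow_card]

end Fields

theorem finrank_graph {K A S : Type*} [Field K] [AddCommGroup A] [Module K A] [AddCommGroup S]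
    [Module K S] (f : A →ₗ[K] S) : finrank K f.graph = finrank K A := by
  rw [LinearMap.graph_eq_range_prod]
  exact LinearMap.finrank_range_of_inj fun x y h => congrArg Prod.fst h

/-! ### Point covers in odd dimension and the recursive step -/

section

variable {K : Type*} [Field K]

/-- A point (b, z) with b ≠ 0 lies on the graph of multiplication by z / b; the given cover handles
0 × F. -/
theorem PointCoverable.prod {F : Type*} [Field F] [Finite F] [Algebra K F] {N : ℕ}
    (h : PointCoverable K F N) (B : Submodule K F) (hB : finrank K B = 2) :
    PointCoverable K (B × F) (Nat.card F + N) := by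
  classical
  have := Fintype.ofFinite F
  obtain ⟨X, hX, h2, hc⟩ := h
  let f : F → B →ₗ[K] F := fun a => LinearMap.mulLeft K a ∘ₗ B.subtype
  refine ⟨Finset.univ.image (fun a => (f a).graph) ∪ X.image (Submodule.map (LinearMap.inr K B F)),
    (Finset.card_union_le _ _).trans (add_le_add ?_ (Finset.card_image_le.trans hX)), ?_, ?_⟩
  · exact Finset.card_image_le.trans (by rw [Finset.card_univ, Fintype.card_eq_nat_card])
  · intro L hL
    rcases Finset.mem_union.1 hL with hL | hL <;> obtain ⟨a, ha, rfl⟩ := Finset.mem_image.1 hL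
    · rw [finrank_graph, hB]
    · rw [← h2 a ha]
      exact (LinearEquiv.finrank_eq
        (Submodule.equivMapOfInjective _ LinearMap.inr_injective _)).symm
  · rintro ⟨b, z⟩ hz
    by_cases hb : b = 0
    · subst hb
      obtain ⟨L, hL, hzL⟩ := hc z (by rintro rfl; exact hz rfl)
      exact ⟨_, Finset.mem_union_right _ (Finset.mem_image_of_mem _ hL), z, hzL, rfl⟩
    · refine ⟨_, Finset.mem_union_left _ (Finset.mem_image_of_mem _ (Finset.mem_univ (z / b.1))), ?_⟩
      have hb' : (b : F) ≠ 0 := fun h => hb (Subtype.ext h)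
      rw [LinearMap.mem_graph_iff]
      simp [f, hb']

/-- Starting from the q + 1 lines of a pencil in a plane, raising the dimension from 2j + 3 by two
costs |F| = q^(2j+3) lines. -/
theorem pointCoverable_of_odd [Finite K] (j : ℕ) : ∀ (S : Type) [AddCommGroup S] [Module K S],
    finrank K S = 2 * j + 3 →
    PointCoverable K S (Nat.card K * theta j (Nat.card K ^ 2) + 1) := by
  induction j with
  | zero =>
    intro S _ _ hS
    have hfd : FiniteDimensional K S := FiniteDimensional.of_finrank_pos (by omega)
    obtain ⟨L, -, hL⟩ := exists_le_finrank_eq (⊥ : Submodule K S) (d := 2) (by simp) (by omega)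
    obtain ⟨X, hX, -, h2, hc⟩ := exists_pencil hS L hL
    exact ⟨X, by simpa [theta] using hX, h2, fun z _ => hc z⟩
  | succ j ih =>
    intro S _ _ hS
    have hfd : FiniteDimensional K S := FiniteDimensional.of_finrank_pos (by omega)
    obtain ⟨F, _, _, _, _, -, hF, -⟩ := exists_cyclic_extension K (2 * j + 3) (by omega)
    obtain ⟨B, -, hB⟩ := exists_le_finrank_eq (⊥ : Submodule K F) (d := 2) (by simp) (by omega)
    have h := (ih F hF).prod B hB
    have e : finrank K (B × F) = finrank K S := by
      rw [finrank_prod, hB, hF, hS]; ring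
    have h' := h.of_linearEquiv (LinearEquiv.ofFinrankEq _ _ e)
    rw [Module.natCard_eq_pow_finrank (K := K), hF] at h'
    rw [theta_succ]
    convert h' using 1
    ring

/-- If the difference vanished, v / u would be fixed by σ, hence lie in K. -/
theorem cross_sub_ne_zero {F : Type*} [Field F] [Algebra K F] (σ : F ≃ₐ[K] F)
    (hσ : ∀ x, σ x = x → ∃ k, algebraMap K F k = x) {u v : F}
    (huv : LinearIndependent K ![u, v]) : u * σ v - σ u * v ≠ 0 := by
  intro h
  have hu : u ≠ 0 := huv.ne_zero 0
  obtain ⟨k, hk⟩ := hσ (v / u) (by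
    have : σ u ≠ 0 := by simpa using hu
    rw [map_div₀]
    field_simp
    linear_combination h)
  refine (LinearIndependent.pair_iff' hu).1 huv k ?_
  rw [Algebra.smul_def, hk]
  field_simp

/-- Cramer's rule, with the determinant of `cross_sub_ne_zero`. -/
theorem exists_interpolation {F : Type*} [Field F] [Algebra K F] (σ : F ≃ₐ[K] F)
    (hσ : ∀ x, σ x = x → ∃ k, algebraMap K F k = x) {u v : F}
    (huv : LinearIndependent K ![u, v]) (s t : F) :
    ∃ a b : F, a * u + b * σ u = s ∧ a * v + b * σ v = t := by
  have h := cross_sub_ne_zero σ hσ huv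
  refine ⟨(s * σ v - t * σ u) / (u * σ v - σ u * v), (t * u - s * v) / (u * σ v - σ u * v), ?_, ?_⟩
  all_goals
    rw [div_mul_eq_mul_div, div_mul_eq_mul_div, ← add_div, div_eq_iff h]
    ring

theorem LineCoverable.exists_of_injective {V V' : Type*} [AddCommGroup V] [Module K V]
    [AddCommGroup V'] [Module K V'] [FiniteDimensional K V] {N : ℕ} (h : LineCoverable K V N)
    (f : V →ₗ[K] V') (hf : Function.Injective f) :
    ∃ X : Finset (Submodule K V'), X.card ≤ N ∧ (∀ U ∈ X, finrank K U ≤ 3) ∧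
      ∀ W ≤ LinearMap.range f, finrank K W = 2 → ∃ U ∈ X, W ≤ U := by
  classical
  obtain ⟨X, hX, h3, hc⟩ := h
  refine ⟨X.image (Submodule.map f), Finset.card_image_le.trans hX, ?_, ?_⟩
  · intro U hU
    obtain ⟨U', hU', rfl⟩ := Finset.mem_image.1 hU
    exact (Submodule.finrank_map_le f U').trans (h3 U' hU')
  · intro W hWf hW
    have e : (W.comap f).map f = W := by rwa [Submodule.map_comap_eq, inf_eq_right]
    obtain ⟨U, hU, hle⟩ := hc (W.comap f) (by
      rw [← hW]
      conv_rhs => rw [← e]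
      exact LinearEquiv.finrank_eq (Submodule.equivMapOfInjective _ hf _))
    exact ⟨_, Finset.mem_image_of_mem _ hU, e ▸ Submodule.map_mono hle⟩

section LiftedPlane

variable {F A : Type*} [Field F] [Algebra K F] [AddCommGroup A] [Module K A]

/-- The planes `{(u, a u + b σ u)}`, where `u` runs through a subspace of `F`. -/
def liftedPlane (σ : F ≃ₐ[K] F) (i : A →ₗ[K] F) (ab : F × F) : Submodule K (A × F) :=
  ((LinearMap.mulLeft K ab.1 + LinearMap.mulLeft K ab.2 ∘ₗ σ.toLinearMap) ∘ₗ i).graph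

theorem mem_liftedPlane (σ : F ≃ₐ[K] F) (i : A →ₗ[K] F) (ab : F × F) (w : A × F) :
    w ∈ liftedPlane σ i ab ↔ w.2 = ab.1 * i w.1 + ab.2 * σ (i w.1) := by
  simp [liftedPlane, LinearMap.mem_graph_iff]

theorem finrank_liftedPlane (σ : F ≃ₐ[K] F) (i : A →ₗ[K] F) (ab : F × F) :
    finrank K (liftedPlane σ i ab) = finrank K A :=
  finrank_graph _

end LiftedPlane

/-- The recursive construction of covering designs. -/
theorem LineCoverable.step [Finite K] {m N M : ℕ} (hm : 3 ≤ m)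
    (hN : LineCoverable K (Fin (m + 1) → K) N)
    (hM : ∀ (S : Type) [AddCommGroup S] [Module K S], finrank K S = m → PointCoverable K S M) :
    LineCoverable K (Fin (m + 3) → K) (Nat.card K ^ (2 * m) + N +
      (Nat.card K ^ 2 + Nat.card K) * (M * Nat.card K ^ (m - 2))) := by
  classical
  obtain ⟨F, _, _, _, _, σ, hF, hσ, -⟩ := exists_cyclic_extension K m (by omega)
  have := Fintype.ofFinite F
  obtain ⟨A, -, hA⟩ := exists_le_finrank_eq (⊥ : Submodule K F) (d := 3) (by simp) (by omega)
  have e : finrank K (A × F) = finrank K (Fin (m + 3) → K) := by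
    rw [finrank_prod, hA, hF, finrank_fin_fun, add_comm]
  refine LineCoverable.of_linearEquiv ?_ (LinearEquiv.ofFinrankEq _ _ e)
  have := Fintype.ofFinite (ℙ K A)
  have hnt : Nontrivial A := nontrivial_of_finrank_pos (R := K) (by omega)
  obtain ⟨x₀, hx₀⟩ := exists_ne (0 : A)
  -- Kp₀ ⊕ F has dimension m + 1, so it carries the smaller design; it contains all lines over p₀
  -- and all lines inside 0 × F.
  let p₀ : ℙ K A := Projectivization.mk K x₀ hx₀
  let f : K × F →ₗ[K] A × F := (LinearMap.toSpanSingleton K A p₀.rep).prodMap LinearMap.id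
  have hf : Function.Injective f := by
    rintro ⟨a, y⟩ ⟨b, z⟩ h
    have h1 := congrArg Prod.fst h
    have h2 := congrArg Prod.snd h
    exact Prod.ext (smul_left_injective K p₀.rep_nonzero h1) h2
  obtain ⟨X, hX, hX3, hXc⟩ := (hN.of_linearEquiv (LinearEquiv.ofFinrankEq _ (K × F) (by
    rw [finrank_fin_fun, finrank_prod, hF, finrank_self, add_comm]))).exists_of_injective f hf
  obtain ⟨Y, hY, hY2, hYc⟩ := hM F hF
  obtain ⟨D, hD, hDY, hDc, -⟩ := exists_coset_family Y hY2
  have hP : Nat.card K ^ 2 + Nat.card K + 1 = Fintype.card (ℙ K A) := by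
    rw [Fintype.card_eq_nat_card, Projectivization.card_of_finrank K A hA]
    simp [Finset.sum_range_succ]
    ring
  refine ⟨(Finset.univ.image (liftedPlane σ A.subtype) ∪ X) ∪
    ((Finset.univ.erase p₀).biUnion fun p => D.image (affinePlane p.rep)), ?_, ?_, ?_⟩
  · refine (Finset.card_union_le _ _).trans (add_le_add ((Finset.card_union_le _ _).trans
      (add_le_add (Finset.card_image_le.trans ?_) hX)) ?_)
    · rw [Finset.card_univ, Fintype.card_eq_nat_card, Nat.card_prod,
        Module.natCard_eq_pow_finrank (K := K), hF, ← pow_add, two_mul]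
    · have h1 : (Finset.univ.erase p₀).card = Nat.card K ^ 2 + Nat.card K := by
        rw [Finset.card_erase_of_mem (Finset.mem_univ _), Finset.card_univ, ← hP,
          Nat.add_sub_cancel]
      rw [← h1]
      refine Finset.card_biUnion_le_card_mul _ _ _ fun p _ => Finset.card_image_le.trans ?_
      rw [hF] at hD
      exact hD.trans (Nat.mul_le_mul_right _ hY)
  · intro U hU
    rcases Finset.mem_union.1 hU with hU | hU
    · rcases Finset.mem_union.1 hU with hU | hU
      · obtain ⟨ab, -, rfl⟩ := Finset.mem_image.1 hU
        exact ((finrank_liftedPlane σ A.subtype ab).trans hA).le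
      · exact hX3 U hU
    · obtain ⟨p, -, hU⟩ := Finset.mem_biUnion.1 hU
      obtain ⟨d, hd, rfl⟩ := Finset.mem_image.1 hU
      exact finrank_affinePlane_le _ _ (hY2 _ (hDY d hd))
  · intro W hW
    rcases finrank_two_cases W hW with ⟨u, v, s, t, huv, rfl⟩ | ⟨p, y, z, hz, rfl⟩ | ⟨L, hL, rfl⟩
    · have huv' : LinearIndependent K ![(u : F), v] := by
        have h := huv.map' A.subtype (Submodule.ker_subtype A)
        have e : A.subtype ∘ ![u, v] = ![(u : F), v] := by
          funext i
          fin_cases i <;> rfl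
        rwa [e] at h
      obtain ⟨a, b, hs, ht⟩ := exists_interpolation σ hσ huv' s t
      refine ⟨liftedPlane σ A.subtype (a, b), Finset.mem_union_left _ (Finset.mem_union_left _
        (Finset.mem_image_of_mem _ (Finset.mem_univ _))), ?_⟩
      rw [Submodule.span_le]
      rintro w (rfl | rfl)
      · exact (mem_liftedPlane _ _ _ _).2 hs.symm
      · exact (mem_liftedPlane _ _ _ _).2 ht.symm
    · by_cases hp : p = p₀
      · subst hp
        obtain ⟨U, hU, hle⟩ := hXc _ (by
          rw [Submodule.span_le]
          rintro w (rfl | rfl)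
          · exact ⟨(1, y), by simp [f]⟩
          · exact ⟨(0, z), by simp [f]⟩) hW
        exact ⟨U, Finset.mem_union_left _ (Finset.mem_union_right _ hU), hle⟩
      · obtain ⟨L, hL, hzL⟩ := hYc z hz
        obtain ⟨d, hd, hdL, hyd⟩ := hDc L hL y
        refine ⟨affinePlane p.rep d, Finset.mem_union_right _ (Finset.mem_biUnion.2
          ⟨p, Finset.mem_erase.2 ⟨hp, Finset.mem_univ _⟩, Finset.mem_image_of_mem _ hd⟩), ?_⟩
        subst hdL
        exact span_le_affinePlane _ _ hyd hzL
    · obtain ⟨U, hU, hle⟩ := hXc (L.map (LinearMap.inr K A F)) (by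
        rintro _ ⟨z, -, rfl⟩
        exact ⟨(0, z), by simp [f]⟩) hW
      exact ⟨U, Finset.mem_union_left _ (Finset.mem_union_right _ hU), hle⟩

end

/-! ### The alternating family and the design in PG(5,q) -/

section AlternatingMaps

variable {K F : Type*} [Field K] [Field F] [Algebra K F]

/-- The alternating map `(a, x) ↦ a σ x - σ a x`. -/
def frobCross (σ : F ≃ₐ[K] F) : F →ₗ[K] F →ₗ[K] F :=
  LinearMap.mk₂ K (fun a x => a * σ x - σ a * x)
    (fun a b x => by rw [map_add]; ring)
    (fun k a x => by rw [map_smul, smul_mul_assoc, smul_mul_assoc, smul_sub])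
    (fun a x y => by rw [map_add]; ring)
    (fun k a x => by rw [map_smul, mul_smul_comm, mul_smul_comm, smul_sub])

theorem frobCross_apply (σ : F ≃ₐ[K] F) (a x : F) : frobCross σ a x = a * σ x - σ a * x := rfl

theorem frobCross_self (σ : F ≃ₐ[K] F) (a : F) : frobCross σ a a = 0 := by
  rw [frobCross_apply]; ring

theorem frobCross_swap (σ : F ≃ₐ[K] F) (a x : F) : frobCross σ a x = -frobCross σ x a := by
  rw [frobCross_apply, frobCross_apply]; ring

/-- By `cross_sub_ne_zero` the kernel is just Kx. -/
theorem finrank_range_frobCross [FiniteDimensional K F] (hF : finrank K F = 3) (σ : F ≃ₐ[K] F)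
    (hσ : ∀ x, σ x = x → ∃ k, algebraMap K F k = x) {x : F} (hx : x ≠ 0) :
    finrank K (LinearMap.range (frobCross σ x)) = 2 := by
  have hker : LinearMap.ker (frobCross σ x) = Submodule.span K {x} := by
    apply le_antisymm
    · intro w hw
      by_contra hsp
      refine cross_sub_ne_zero σ hσ (u := x) (v := w) ?_ hw
      rw [LinearIndependent.pair_iff' hx]
      exact fun a ha => hsp (Submodule.mem_span_singleton.2 ⟨a, ha⟩)
    · rw [Submodule.span_le]
      rintro w rfl
      exact frobCross_self σ _
  have h := LinearMap.finrank_range_add_finrank_ker (frobCross σ x)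
  rw [hker, finrank_span_singleton hx, hF] at h
  omega

/-- Every line of the plane `PG(F)` is the image of one of the alternating maps. -/
theorem exists_range_frobCross_eq [FiniteDimensional K F] [Algebra.IsSeparable K F]
    (hF : finrank K F = 3) (σ : F ≃ₐ[K] F)
    (hσ : ∀ x, σ x = x → ∃ k, algebraMap K F k = x) (hσ3 : ∀ x, σ^[3] x = x)
    (L : Submodule K F) (hL : finrank K L = 2) :
    ∃ p : ℙ K F, LinearMap.range (frobCross σ p.rep) = L := by
  have hLt : L < ⊤ := lt_top_iff_ne_top.2 (by rintro rfl; rw [finrank_top] at hL; omega)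
  obtain ⟨φ, hφ, hLφ⟩ := L.exists_le_ker_of_lt_top hLt
  -- L is the kernel of z ↦ Tr(dz); the required point turns out to be that of σd.
  obtain ⟨d, hd⟩ := ((Algebra.traceForm K F).toDual (traceForm_nondegenerate K F)).surjective φ
  have hφd : ∀ z, φ z = Algebra.trace K F (d * z) := by
    intro z
    rw [← hd, LinearMap.BilinForm.toDual_def, Algebra.traceForm_apply]
  have hd0 : d ≠ 0 := by
    rintro rfl
    exact hφ (LinearMap.ext fun z => by simp [hφd])
  have hx : σ d ≠ 0 := by simpa using hd0
  obtain ⟨k, hk⟩ := Projectivization.exists_smul_eq_mk_rep K (σ d) hx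
  refine ⟨Projectivization.mk K (σ d) hx, ?_⟩
  have hker : finrank K (LinearMap.ker φ) = 2 := by
    have := Module.Dual.finrank_ker_add_one_of_ne_zero hφ
    omega
  rw [Submodule.eq_of_le_of_finrank_eq hLφ (hL.trans hker.symm)]
  refine Submodule.eq_of_le_of_finrank_eq ?_
    ((finrank_range_frobCross hF σ hσ (Projectivization.rep_nonzero _)).trans hker.symm)
  rintro _ ⟨w, rfl⟩
  rw [← hk, Units.smul_def, map_smul, LinearMap.smul_apply]
  refine Submodule.smul_mem _ _ ?_
  rw [LinearMap.mem_ker, hφd, frobCross_apply]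
  have h3 : σ (σ (σ d)) = d := hσ3 d
  -- As σ³d = d, the value has the form σc - c, which has trace zero.
  have e : d * (σ d * σ w - σ (σ d) * w) = σ (d * σ (σ d) * w) - d * σ (σ d) * w := by
    rw [map_mul, map_mul, h3]
    ring
  rw [e, map_sub, Algebra.trace_eq_of_algEquiv, sub_self]

/-- The span of the values of the alternating map on `U`. -/
def frobCrossSpan (σ : F ≃ₐ[K] F) (U : Submodule K F) : Submodule K F :=
  Submodule.span K {z | ∃ u ∈ U, ∃ v ∈ U, frobCross σ u v = z}

theorem frobCross_mem_frobCrossSpan (σ : F ≃ₐ[K] F) {U : Submodule K F} {u v : F} (hu : u ∈ U)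
    (hv : v ∈ U) : frobCross σ u v ∈ frobCrossSpan σ U :=
  Submodule.subset_span ⟨u, hu, v, hv, rfl⟩

/-- An alternating map on a 2-dimensional space takes only multiples of its value on a basis. -/
theorem finrank_frobCrossSpan_le [FiniteDimensional K F] (σ : F ≃ₐ[K] F) (U : Submodule K F)
    (hU : finrank K U = 2) : finrank K (frobCrossSpan σ U) ≤ 1 := by
  let b := finBasisOfFinrankEq K U hU
  have hb : ∀ u ∈ U, ∃ α β : K, u = α • (b 0 : F) + β • (b 1 : F) := by
    intro u hu
    have h := b.sum_repr ⟨u, hu⟩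
    rw [Fin.sum_univ_two] at h
    exact ⟨_, _, (congrArg Subtype.val h).symm⟩
  have hle : frobCrossSpan σ U ≤ Submodule.span K {frobCross σ (b 0) (b 1)} := by
    rw [frobCrossSpan, Submodule.span_le]
    rintro _ ⟨u, hu, v, hv, rfl⟩
    obtain ⟨α, β, rfl⟩ := hb u hu
    obtain ⟨γ, δ, rfl⟩ := hb v hv
    refine Submodule.mem_span_singleton.2 ⟨α * δ - β * γ, ?_⟩
    simp only [map_add, map_smul, LinearMap.add_apply, LinearMap.smul_apply, frobCross_self,
      frobCross_swap σ (b 1 : F) (b 0)]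
    module
  refine (Submodule.finrank_mono hle).trans ?_
  simpa using finrank_span_le_card (R := K) ({frobCross σ (b 0 : F) (b 1)} : Set F)

/-- The planes `{(u, f_c(u) + y) : u ∈ U, y ∈ f_U(U)}`, where `f` is the alternating map. -/
def alternatingPlane (σ : F ≃ₐ[K] F) (D : Submodule K F × F) : Submodule K (F × F) :=
  D.1.map (LinearMap.id.prod (frobCross σ D.2)) ⊔ (frobCrossSpan σ D.1).map (LinearMap.inr K F F)

theorem finrank_alternatingPlane_le [FiniteDimensional K F] (σ : F ≃ₐ[K] F)
    (D : Submodule K F × F) (hD : finrank K D.1 = 2) : finrank K (alternatingPlane σ D) ≤ 3 := by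
  have h1 := Submodule.finrank_add_le_finrank_add_finrank
    (D.1.map (LinearMap.id.prod (frobCross σ D.2))) ((frobCrossSpan σ D.1).map (LinearMap.inr K F F))
  have h2 := Submodule.finrank_map_le (LinearMap.id.prod (frobCross σ D.2)) D.1
  have h3 := Submodule.finrank_map_le (LinearMap.inr K F F) (frobCrossSpan σ D.1)
  have h4 := finrank_frobCrossSpan_le σ D.1 hD
  rw [alternatingPlane]
  omega

/-- On U, f_b and f_c differ by values in f(U, U) when b - c ∈ U, so only the coset of b modulo U
matters. -/
theorem mem_alternatingPlane (σ : F ≃ₐ[K] F) {D : Submodule K F × F} {u b : F} (hu : u ∈ D.1)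
    (hb : b - D.2 ∈ D.1) : (u, frobCross σ b u) ∈ alternatingPlane σ D := by
  have e : (u, frobCross σ b u) = (u, frobCross σ D.2 u) + (0, frobCross σ (b - D.2) u) := by
    ext <;> simp
  rw [e]
  exact add_mem (Submodule.mem_sup_left ⟨u, hu, rfl⟩)
    (Submodule.mem_sup_right ⟨_, frobCross_mem_frobCrossSpan σ hb hu, rfl⟩)

theorem inr_mem_alternatingPlane (σ : F ≃ₐ[K] F) {D : Submodule K F × F} {u v : F} (hu : u ∈ D.1)
    (hv : v ∈ D.1) : (0, frobCross σ u v) ∈ alternatingPlane σ D :=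
  Submodule.mem_sup_right ⟨_, frobCross_mem_frobCrossSpan σ hu hv, rfl⟩

/-- A covering design in `PG(5, q)`. -/
theorem lineCoverable_six (K : Type*) [Field K] [Finite K] :
    LineCoverable K (Fin 6 → K) ((Nat.card K ^ 6 - Nat.card K ^ 3) +
      (Nat.card K ^ 2 + Nat.card K + 1) * Nat.card K +
      (Nat.card K ^ 2 + Nat.card K + 1) * ((Nat.card K + 1) * Nat.card K - 1)) := by
  classical
  obtain ⟨F, _, _, _, _, σ, hF, hσ, hσ3⟩ := exists_cyclic_extension K 3 (by omega)
  have := Fintype.ofFinite F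
  refine LineCoverable.of_linearEquiv ?_ (LinearEquiv.ofFinrankEq (F × F) _ (by
    rw [finrank_prod, hF, finrank_fin_fun]))
  have := Fintype.ofFinite (ℙ K F)
  have hcF : Fintype.card F = Nat.card K ^ 3 := by
    rw [Fintype.card_eq_nat_card, Module.natCard_eq_pow_finrank (K := K), hF]
  have hP : Fintype.card (ℙ K F) = Nat.card K ^ 2 + Nat.card K + 1 := by
    rw [Fintype.card_eq_nat_card, Projectivization.card_of_finrank K F hF]
    simp [Finset.sum_range_succ]
    ring
  let ℓ : ℙ K F → Submodule K F := fun p => LinearMap.range (frobCross σ p.rep)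
  have hℓ : ∀ p, finrank K (ℓ p) = 2 := fun p =>
    finrank_range_frobCross hF σ hσ p.rep_nonzero
  have hLℓ : ∀ L : Submodule K F, finrank K L = 2 → ∃ p, ℓ p = L :=
    exists_range_frobCross_eq hF σ hσ hσ3
  obtain ⟨D₁, hD₁, hD₁ℓ, hD₁c, -⟩ := exists_coset_family (Finset.univ.image ℓ) (by
    intro L hL
    obtain ⟨p, -, rfl⟩ := Finset.mem_image.1 hL
    exact hℓ p)
  have hD₁2 : ∀ d ∈ D₁, finrank K d.1 = 2 := by
    intro d hd
    obtain ⟨p, -, hp⟩ := Finset.mem_image.1 (hD₁ℓ d hd)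
    rw [← hp]
    exact hℓ p
  have hD₁u : ∀ U : Submodule K F, finrank K U = 2 → ∀ b, ∃ d ∈ D₁, d.1 = U ∧ b - d.2 ∈ U := by
    intro U hU b
    obtain ⟨p, rfl⟩ := hLℓ U hU
    exact hD₁c _ (Finset.mem_image_of_mem _ (Finset.mem_univ p)) b
  -- Over p, the pair y, z ∈ ℓ p is left to the alternating planes, so the zero coset of ℓ p can be
  -- dropped from a pencil containing ℓ p.
  have hD₂ : ∀ p, ∃ D : Finset (Submodule K F × F),
      D.card ≤ (Nat.card K + 1) * Nat.card K - 1 ∧ (∀ d ∈ D, finrank K d.1 = 2) ∧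
      (∀ y z, (y ∈ ℓ p ∧ z ∈ ℓ p) ∨ ∃ d ∈ D, y - d.2 ∈ d.1 ∧ z ∈ d.1) ∧
      ∃ d ∈ D, d.1 = ℓ p := by
    intro p
    obtain ⟨X, hX, hpX, hX2, hXc⟩ := exists_pencil hF (ℓ p) (hℓ p)
    obtain ⟨D, hD, hDX, hDc, hD0⟩ := exists_coset_family X hX2
    obtain ⟨d₀, hd₀, hd₀ℓ, hd₀0⟩ := hD0 _ hpX
    refine ⟨D.erase d₀, ?_, fun d hd => hX2 _ (hDX d (Finset.mem_of_mem_erase hd)), ?_, ?_⟩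
    · rw [Finset.card_erase_of_mem hd₀]
      rw [hF, pow_one] at hD
      exact Nat.sub_le_sub_right (hD.trans (Nat.mul_le_mul_right _ hX)) 1
    · intro y z
      obtain ⟨M, hM, hzM⟩ := hXc z
      obtain ⟨d, hd, rfl, hy⟩ := hDc M hM y
      by_cases h : d = d₀
      · subst h
        rw [hd₀ℓ] at hy hzM
        exact Or.inl ⟨by simpa using add_mem hy hd₀0, hzM⟩
      · exact Or.inr ⟨d, Finset.mem_erase.2 ⟨h, hd⟩, hy, hzM⟩
    -- Another coset of ℓ p survives; its affine plane still contains 0 × ℓ p, as needed for the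
    -- lines inside 0 × F.
    · have hlt : ℓ p < ⊤ := lt_top_iff_ne_top.2 (by
        intro h
        have := hℓ p
        rw [h, finrank_top] at this
        omega)
      obtain ⟨y, -, hy⟩ := SetLike.exists_of_lt hlt
      obtain ⟨d, hd, hdℓ, hyd⟩ := hDc _ hpX y
      refine ⟨d, Finset.mem_erase.2 ⟨?_, hd⟩, hdℓ⟩
      rintro rfl
      exact hy (by simpa using add_mem hyd hd₀0)
  choose D₂ hD₂card hD₂2 hD₂c hD₂ℓ using hD₂
  refine ⟨((Finset.univ.filter fun ab : F × F => ¬ab.1 = -σ ab.2).image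
      (liftedPlane σ LinearMap.id) ∪ D₁.image (alternatingPlane σ)) ∪
      Finset.univ.biUnion fun p => (D₂ p).image (affinePlane p.rep), ?_, ?_, ?_⟩
  · refine (Finset.card_union_le _ _).trans (add_le_add ((Finset.card_union_le _ _).trans
      (add_le_add (Finset.card_image_le.trans ?_) (Finset.card_image_le.trans ?_))) ?_)
    · have h1 := Finset.card_filter_add_card_filter_not (s := (Finset.univ : Finset (F × F)))
        (fun ab : F × F => ab.1 = -σ ab.2)
      have h2 : (Finset.univ.image fun b : F => (-σ b, b)) ⊆
          Finset.univ.filter fun ab : F × F => ab.1 = -σ ab.2 := by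
        intro ab hab
        obtain ⟨b, -, rfl⟩ := Finset.mem_image.1 hab
        simp
      have h3 := Finset.card_le_card h2
      rw [Finset.card_image_of_injective _ (fun a b h => congrArg Prod.snd h),
        Finset.card_univ, hcF] at h3
      rw [Finset.card_univ, Fintype.card_prod, hcF, ← pow_add, show 3 + 3 = 6 from rfl] at h1
      omega
    · rw [hF, pow_one] at hD₁
      refine hD₁.trans (Nat.mul_le_mul_right _ (Finset.card_image_le.trans ?_))
      rw [Finset.card_univ, hP]
    · rw [← hP, ← Finset.card_univ]
      exact Finset.card_biUnion_le_card_mul _ _ _ fun p _ =>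
        Finset.card_image_le.trans (hD₂card p)
  · intro U hU
    rcases Finset.mem_union.1 hU with hU | hU
    · rcases Finset.mem_union.1 hU with hU | hU
      · obtain ⟨ab, -, rfl⟩ := Finset.mem_image.1 hU
        exact ((finrank_liftedPlane σ LinearMap.id ab).trans hF).le
      · obtain ⟨d, hd, rfl⟩ := Finset.mem_image.1 hU
        exact finrank_alternatingPlane_le σ d (hD₁2 d hd)
    · obtain ⟨p, -, hU⟩ := Finset.mem_biUnion.1 hU
      obtain ⟨d, hd, rfl⟩ := Finset.mem_image.1 hU
      exact finrank_affinePlane_le _ _ (hD₂2 p d hd)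
  · intro W hW
    rcases finrank_two_cases W hW with ⟨u, v, s, t, huv, rfl⟩ | ⟨p, y, z, hz, rfl⟩ | ⟨L, hL, rfl⟩
    · obtain ⟨a, b, hs, ht⟩ := exists_interpolation σ hσ huv s t
      -- Here u ↦ au + bσu is the alternating map f_b, whose graph was removed.
      by_cases hab : a = -σ b
      · obtain ⟨d, hd, hdU, hbd⟩ := hD₁u (Submodule.span K (Set.range ![u, v]))
          (by rw [finrank_span_eq_card huv, Fintype.card_fin]) b
        refine ⟨alternatingPlane σ d, Finset.mem_union_left _ (Finset.mem_union_right _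
          (Finset.mem_image_of_mem _ hd)), ?_⟩
        rw [← hdU] at hbd
        rw [Submodule.span_le]
        rintro w (rfl | rfl)
        · have e : s = frobCross σ b u := by rw [← hs, frobCross_apply, hab]; ring
          rw [e]
          exact mem_alternatingPlane σ (hdU ▸ Submodule.subset_span ⟨0, rfl⟩) hbd
        · have e : t = frobCross σ b v := by rw [← ht, frobCross_apply, hab]; ring
          rw [e]
          exact mem_alternatingPlane σ (hdU ▸ Submodule.subset_span ⟨1, rfl⟩) hbd
      · refine ⟨liftedPlane σ LinearMap.id (a, b), Finset.mem_union_left _ (Finset.mem_union_left _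
          (Finset.mem_image_of_mem _ (by simpa using hab))), ?_⟩
        rw [Submodule.span_le]
        rintro w (rfl | rfl)
        · exact (mem_liftedPlane _ _ _ _).2 hs.symm
        · exact (mem_liftedPlane _ _ _ _).2 ht.symm
    · rcases hD₂c p y z with ⟨⟨b, hb⟩, w, hw⟩ | ⟨d, hd, hy, hzd⟩
      -- With y = f(p, b) = f(-b, p) and z = f(p, w), the line lies in the alternating plane for U =
      -- ⟨p, w⟩ and the coset of -b.
      · have hli : LinearIndependent K ![p.rep, w] := by
          rw [LinearIndependent.pair_iff' p.rep_nonzero]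
          rintro a rfl
          rw [map_smul, frobCross_self, smul_zero] at hw
          exact hz hw.symm
        obtain ⟨d, hd, hdU, hbd⟩ := hD₁u (Submodule.span K (Set.range ![p.rep, w]))
          (by rw [finrank_span_eq_card hli, Fintype.card_fin]) (-b)
        refine ⟨alternatingPlane σ d, Finset.mem_union_left _ (Finset.mem_union_right _
          (Finset.mem_image_of_mem _ hd)), ?_⟩
        rw [← hdU] at hbd
        have h0 : p.rep ∈ d.1 := hdU ▸ Submodule.subset_span ⟨0, rfl⟩
        have h1 : w ∈ d.1 := hdU ▸ Submodule.subset_span ⟨1, rfl⟩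
        rw [Submodule.span_le]
        rintro _ (rfl | rfl)
        · have e : y = frobCross σ (-b) p.rep := by
            rw [← hb, frobCross_swap, map_neg, LinearMap.neg_apply]
          rw [e]
          exact mem_alternatingPlane σ h0 hbd
        · rw [← hw]
          exact inr_mem_alternatingPlane σ h0 h1
      · exact ⟨_, Finset.mem_union_right _ (Finset.mem_biUnion.2
          ⟨p, Finset.mem_univ _, Finset.mem_image_of_mem _ hd⟩), span_le_affinePlane _ _ hy hzd⟩
    · obtain ⟨p, rfl⟩ := hLℓ L hL
      obtain ⟨d, hd, hdℓ⟩ := hD₂ℓ p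
      refine ⟨_, Finset.mem_union_right _ (Finset.mem_biUnion.2
        ⟨p, Finset.mem_univ _, Finset.mem_image_of_mem _ hd⟩), ?_⟩
      rintro _ ⟨z, hz, rfl⟩
      exact inr_mem_affinePlane _ _ (hdℓ ▸ hz)

end AlternatingMaps

/-! ### Evaluation of the recursion -/

/-- The upper bound for the covering number. -/
def coveringBound (q n : ℕ) : ℤ :=
  (q : ℤ) ^ (2 * n - 2) * (theta (n - 2) (q ^ 2) : ℤ) + (q : ℤ) ^ (2 * n - 3) - 1
    + ∑ i ∈ Finset.Icc 2 (n - 1),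
        ((theta (4 * i - 5) q : ℤ) - (theta (2 * i - 4) q : ℤ) + (q : ℤ) ^ (2 * i - 2))

theorem theta_mul_sub_one_int (m q : ℕ) :
    (theta m q : ℤ) * ((q : ℤ) - 1) = (q : ℤ) ^ (m + 1) - 1 := by
  exact_mod_cast theta_mul_sub_one m q

/-- The right side is the count in `LineCoverable.step` for m = 2k + 5, with the point cover of
`pointCoverable_of_odd`. -/
theorem coveringBound_succ {q : ℕ} (hq : 1 < q) (k : ℕ) :
    coveringBound q (k + 4) = (q : ℤ) ^ (2 * (2 * k + 5)) + coveringBound q (k + 3) +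
      ((q : ℤ) ^ 2 + q) * ((q * theta (k + 1) (q ^ 2) + 1) * (q : ℤ) ^ (2 * k + 3)) := by
  have hI : Finset.Icc 2 (k + 3) = insert (k + 3) (Finset.Icc 2 (k + 2)) :=
    (Finset.insert_Icc_right_eq_Icc_add_one (by omega)).symm
  have h1 := theta_mul_sub_one_int (k + 1) (q ^ 2)
  have h2 := theta_mul_sub_one_int (4 * k + 7) q
  have h3 := theta_mul_sub_one_int (2 * k + 2) q
  have hq' : (q : ℤ) - 1 ≠ 0 := by
    have : (1 : ℤ) < q := by exact_mod_cast hq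
    omega
  simp only [coveringBound, show k + 4 - 1 = k + 3 by omega, show k + 3 - 1 = k + 2 by omega, hI]
  rw [Finset.sum_insert (by simp)]
  simp only [show 2 * (k + 4) - 2 = 2 * k + 6 by omega, show 2 * (k + 4) - 3 = 2 * k + 5 by omega,
    show k + 4 - 2 = k + 1 + 1 by omega, show 4 * (k + 3) - 5 = 4 * k + 7 by omega,
    show 2 * (k + 3) - 4 = 2 * k + 2 by omega, show 2 * (k + 3) - 2 = 2 * k + 4 by omega,
    show 2 * (k + 3) - 3 = 2 * k + 3 by omega, show k + 3 - 2 = k + 1 by omega, theta_succ (k + 1)]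
  -- Multiplying by q - 1 telescopes the geometric sums.
  apply mul_right_cancel₀ hq'
  push_cast at h1 ⊢
  linear_combination (q : ℤ) ^ (2 * k + 4) * (q - 1 - q) * h1 + h2 - h3

theorem exists_lineCoverable (K : Type*) [Field K] [Finite K] (k : ℕ) :
    ∃ N : ℕ, LineCoverable K (Fin (2 * (k + 3)) → K) N ∧
      (N : ℤ) = coveringBound (Nat.card K) (k + 3) := by
  have hq : 1 < Nat.card K := Finite.one_lt_card
  induction k with
  | zero =>
    refine ⟨_, lineCoverable_six K, ?_⟩
    have h1 : Nat.card K ^ 3 ≤ Nat.card K ^ 6 := Nat.pow_le_pow_right (by omega) (by norm_num)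
    have h2 : 1 ≤ (Nat.card K + 1) * Nat.card K := Nat.mul_pos (by omega) (by omega)
    push_cast [Nat.cast_sub h1, Nat.cast_sub h2]
    simp [coveringBound, theta, Finset.sum_range_succ]
    ring
  | succ k ih =>
    obtain ⟨N, hN, hNe⟩ := ih
    -- With m = 2k + 5 the dimensions m + 1 and m + 3 are 2(k + 3) and 2(k + 4), and m = 2(k + 1) +
    -- 3 is odd.
    refine ⟨_, LineCoverable.step (m := 2 * k + 5) (by omega) hN fun S _ _ hS =>
      pointCoverable_of_odd (k + 1) S (by omega), ?_⟩
    rw [show k + 1 + 3 = k + 4 by omega, coveringBound_succ hq, ← hNe,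
      show 2 * k + 5 - 2 = 2 * k + 3 by omega]
    push_cast
    ring

theorem corollary3p4 {K : Type*} [Field K] [Finite K] (q : ℕ) (hq : Nat.card K = q)
    (n : ℕ) (hn : 3 ≤ n) :
    ⌈((theta (n - 1) (q ^ 2) : ℚ) * (theta (2 * n - 2) q : ℚ)) / ((q : ℚ) ^ 2 + (q : ℚ) + 1)⌉
        ≤ (coveringNumber K (2 * n) 3 2 : ℤ) ∧
    (coveringNumber K (2 * n) 3 2 : ℤ) ≤
      (q : ℤ) ^ (2 * n - 2) * (theta (n - 2) (q ^ 2) : ℤ) + (q : ℤ) ^ (2 * n - 3) - 1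
        + ∑ i ∈ Finset.Icc 2 (n - 1),
            ((theta (4 * i - 5) q : ℤ) - (theta (2 * i - 4) q : ℤ) + (q : ℤ) ^ (2 * i - 2)) := by
  obtain ⟨k, rfl⟩ : ∃ k, n = k + 3 := ⟨n - 3, by omega⟩
  refine ⟨ceil_le_coveringNumber q hq _ (by omega), ?_⟩
  obtain ⟨N, hN, hNe⟩ := exists_lineCoverable K k
  rw [hq] at hNe
  have h := hN.coveringNumber_le (by omega)
  exact (Nat.cast_le.2 h).trans hNe.le
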